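/- Let $f\colon X\to Y$ be a continuous map between connected, locally path-connected, semilocally simply-connected topological spaces (no Hausdorff hypothesis; connected spaces are nonempty), let $x_0\in X$, and let $f_\sharp\colon\pi_1(X,x_0)\to\pi_1(Y,f(x_0))$ be the induced homomorphism. For a space $Z$, let $\mathrm{Cov}(Z)$ be the category whose objects are the covering maps $p\colon E\to Z$ ($E$ may be disconnected or empty) and whose morphisms from $p_1\colon E_1\to Z$ to $p_2\colon E_2\to Z$ are the continuous maps $t\colon E_1\to E_2$ with $p_2\circ t=p_1$. Let $f^*\colon\mathrm{Cov}(Y)\to\mathrm{Cov}(X)$ be the pullback functor, which sends $p\colon E\to Y$ to the first-coordinate projection $f^*(E)=\{(x,e)\in X\times E \mid f(x)=p(e)\}\to X$ and sends a morphism $t$ to the restriction of $\mathrm{id}_X\times t$. Then $f_\sharp$ is surjective if and only if $f^*$ is essentially injective, that is, for all coverings $E_1,E_2$ of $Y$, if $f^*(E_1)\cong f^*(E_2)$ in $\mathrm{Cov}(X)$, then $E_1\cong E_2$ in $\mathrm{Cov}(Y)$. -/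

import Mathlib

open CategoryTheory Topology

universe u

/-- Every point has a neighbourhood `U` such that each loop in `U` based at that point is
null-homotopic in the whole space, i.e. `π₁(U, x) → π₁(X, x)` is trivial. -/
class SemilocallySimplyConnectedSpace (X : Type u) [TopologicalSpace X] : Prop where
  exists_nhds_homotopic_refl : ∀ x : X, ∃ U ∈ 𝓝 x, ∀ γ : Path x x,
    Set.range γ ⊆ U → γ.Homotopic (Path.refl x)

/-- A covering of `Y`; the total space may be disconnected or empty. -/
structure Cov (Y : Type u) [TopologicalSpace Y] where
  total : Type u
  [top : TopologicalSpace total]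
  proj : total → Y
  isCoveringMap : IsCoveringMap proj

namespace Cov

attribute [instance] Cov.top

variable {X Y : Type u} [TopologicalSpace X] [TopologicalSpace Y]

/-- A morphism of coverings of `Y`: a continuous map of total spaces over `Y`. -/
@[ext]
structure Hom (E₁ E₂ : Cov Y) where
  map : C(E₁.total, E₂.total)
  comm : ∀ e, E₂.proj (map e) = E₁.proj e

instance : Category (Cov Y) where
  Hom := Hom
  id E := ⟨ContinuousMap.id _, fun _ => rfl⟩
  comp s t := ⟨t.map.comp s.map, fun e => (t.comm _).trans (s.comm e)⟩

/-- The total space `{(x, e) ∈ X × E | f x = p e}` of the pullback. -/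
abbrev PullbackTotal (f : C(X, Y)) (E : Cov Y) : Type u :=
  {z : X × E.total // f z.1 = E.proj z.2}

/-- The projection of the pullback to `X` is a covering map. -/
theorem isCoveringMap_pullback (f : C(X, Y)) (E : Cov Y) :
    IsCoveringMap (fun z : PullbackTotal f E => z.1.1) := by
  intro x
  obtain ⟨hd, U, hxU, hU, -, H, hH⟩ := E.isCoveringMap (f x)
  have hS : ∀ (y : U) (i : E.proj ⁻¹' {f x}), E.proj (H.symm (y, i)).1 = y.1 := by
    intro y i
    rw [← hH, H.apply_symm_apply]
  have key : IsEvenlyCovered (fun z : PullbackTotal f E => z.1.1) x (E.proj ⁻¹' {f x}) := by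
    refine ⟨hd, f ⁻¹' U, hxU, hU.preimage f.continuous,
      (hU.preimage f.continuous).preimage (continuous_fst.comp continuous_subtype_val),
      { toFun := fun z => (⟨z.1.1.1, z.2⟩, (H ⟨z.1.1.2, by
          have h : f z.1.1.1 ∈ U := z.2
          rwa [z.1.2] at h⟩).2)
        invFun := fun w => ⟨⟨(w.1.1, (H.symm (⟨f w.1.1, w.1.2⟩, w.2)).1), (hS ⟨f w.1.1, w.1.2⟩ w.2).symm⟩, w.1.2⟩
        left_inv := ?_
        right_inv := ?_
        continuous_toFun := by fun_prop
        continuous_invFun := by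
          have hc : Continuous fun w : (f ⁻¹' U) × (E.proj ⁻¹' {f x}) =>
              ((⟨f w.1.1, w.1.2⟩ : U), w.2) := by fun_prop
          exact ((continuous_subtype_val.comp continuous_fst).prodMk (continuous_subtype_val.comp
            (H.symm.continuous.comp hc))).subtype_mk _ |>.subtype_mk _ }, fun _ => rfl⟩
    · rintro ⟨⟨⟨a, e⟩, hae⟩, ha⟩
      have he : e ∈ E.proj ⁻¹' U := by
        have h : f a ∈ U := ha
        rwa [show f a = E.proj e from hae] at h
      have h1 : ((⟨f a, ha⟩ : U), (H ⟨e, he⟩).2) = H ⟨e, he⟩ :=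
        Prod.ext (Subtype.ext (by rw [hH]; exact hae)) rfl
      apply Subtype.ext
      apply Subtype.ext
      apply Prod.ext
      · rfl
      · change (H.symm ((⟨f a, ha⟩ : U), (H ⟨e, he⟩).2)).1 = e
        rw [h1, H.symm_apply_apply]
    · rintro ⟨⟨a, ha⟩, i⟩
      apply Prod.ext
      · rfl
      · change (H (H.symm (⟨f a, ha⟩, i))).2 = i
        rw [H.apply_symm_apply]
  exact key.to_isEvenlyCovered_preimage

/-- The topological pullback functor `f^* : Cov Y ⥤ Cov X`. -/
def pullback (f : C(X, Y)) : Cov Y ⥤ Cov X where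
  obj E := ⟨PullbackTotal f E, fun z => z.1.1, isCoveringMap_pullback f E⟩
  map {E₁ E₂} t :=
    { map :=
        { toFun := fun z : PullbackTotal f E₁ =>
            (⟨(z.1.1, Hom.map t z.1.2), z.2.trans (Hom.comm t z.1.2).symm⟩ : PullbackTotal f E₂)
          continuous_toFun := by fun_prop }
      comm := fun _ => rfl }

end Cov

/-- A functor is essentially injective if `F x ≅ F y` implies `x ≅ y`. -/
def EssentiallyInjective {C D : Type*} [Category C] [Category D] (F : C ⥤ D) : Prop :=
  ∀ x y : C, Nonempty (F.obj x ≅ F.obj y) → Nonempty (x ≅ y)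

open Path.Homotopic (Quotient)

/-! Over a path-connected, locally path-connected base, a morphism of coverings amounts to a
π₁-equivariant map of fibres over one point. An isomorphism f^*E₁ ≅ f^*E₂ restricts over x₀ to a
bijection of the fibres over f(x₀), equivariant for H = im f_♯. If H is all of π₁(Y), this bijection
and its inverse extend over Y (`Cov.exists_hom_of_equivariant`).

Conversely, let F be the covering of Y whose fibre over f(x₀) is the set of cosets of H. Its
pullback to X has a section, and shifting along that section as in Hilbert's hotel lets f^*(F × ℕ)
absorb one more trivial sheet (`prodNatEquivOption_map`). So F × ℕ and (F × ℕ) ⊔ Y become isomorphic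
over X. If they are isomorphic over Y, the extra sheet is a section of F × ℕ, hence gives a coset
fixed by π₁(Y), which forces H = π₁(Y) (`LocalSystem.surjective_of_coset_invariant`). These
coverings are built from local systems, so that continuity reduces to compatibility with transport
along paths. -/

theorem Path.Homotopic.Quotient.map_trans {X Y : Type*} [TopologicalSpace X] [TopologicalSpace Y]
    {a b c : X} (γ : Quotient a b) (δ : Quotient b c) (f : C(X, Y)) :
    (γ.trans δ).map f = (γ.map f).trans (δ.map f) :=
  (FundamentalGroupoid.map f).map_comp (X := ⟨a⟩) (Y := ⟨b⟩) (Z := ⟨c⟩) γ δ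

theorem Path.Homotopic.Quotient.map_symm {X Y : Type*} [TopologicalSpace X] [TopologicalSpace Y]
    {a b : X} (γ : Quotient a b) (f : C(X, Y)) : γ.symm.map f = (γ.map f).symm := by
  induction γ with | mk γ => rfl

/-! ### Local path-connectedness and continuity of lifts -/

theorem IsLocalHomeomorph.locallyPathConnectedSpace {E X : Type*} [TopologicalSpace E]
    [TopologicalSpace X] [LocallyPathConnectedSpace X] {p : E → X} (hp : IsLocalHomeomorph p) :
    LocallyPathConnectedSpace E := by
  rw [locallyPathConnectedSpace_iff_pathComponentIn_mem_nhds]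
  intro e u hu heu
  obtain ⟨φ, he, -⟩ := hp e
  have hO : IsOpen (φ '' (φ.source ∩ u)) :=
    φ.isOpen_image_of_subset_source (φ.open_source.inter hu) Set.inter_subset_left
  have hm : φ e ∈ φ '' (φ.source ∩ u) := ⟨e, ⟨he, heu⟩, rfl⟩
  set C := pathComponentIn (φ '' (φ.source ∩ u)) (φ e) with hC
  have hCO : C ⊆ φ '' (φ.source ∩ u) := pathComponentIn_subset
  have hCt : C ⊆ φ.target := fun y hy => by
    obtain ⟨z, hz, rfl⟩ := hCO hy
    exact φ.map_source hz.1
  have hCu : φ.symm '' C ⊆ u := by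
    rintro _ ⟨y, hy, rfl⟩
    obtain ⟨z, hz, rfl⟩ := hCO hy
    rw [φ.left_inv hz.1]
    exact hz.2
  have hCopen : IsOpen C := hO.pathComponentIn _
  have hpc : IsPathConnected (φ.symm '' C) :=
    (isPathConnected_pathComponentIn hm).image' (φ.continuousOn_symm.mono hCt)
  have heC : e ∈ φ.symm '' C := ⟨φ e, mem_pathComponentIn_self hm, φ.left_inv he⟩
  refine Filter.mem_of_superset ((φ.symm.isOpen_image_of_subset_source hCopen hCt).mem_nhds heC) ?_
  exact hpc.subset_pathComponentIn heC hCu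

/-- A set-theoretic lift of a continuous map to a covering space is continuous as soon as it is
compatible with monodromy. -/
theorem IsCoveringMap.continuous_of_monodromy {A E Y : Type*} [TopologicalSpace A]
    [TopologicalSpace E] [TopologicalSpace Y] [LocallyPathConnectedSpace A] {p : E → Y}
    (cov : IsCoveringMap p) {q : A → Y} (hq : Continuous q) {s : A → E} (hs : ∀ a, p (s a) = q a)
    (h : ∀ (a b : A) (η : Path a b),
      cov.monodromy (.mk (η.map hq)) ⟨s a, hs a⟩ = ⟨s b, hs b⟩) : Continuous s := by
  rw [continuous_iff_continuousAt]
  intro a N hN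
  obtain ⟨N', hN'N, hN', haN'⟩ := mem_nhds_iff.mp hN
  obtain ⟨φ, ha, rfl⟩ := cov.isLocalHomeomorph (s a)
  have hO : IsOpen (φ '' (φ.source ∩ N')) :=
    φ.isOpen_image_of_subset_source (φ.open_source.inter hN') Set.inter_subset_left
  have hm : a ∈ q ⁻¹' (φ '' (φ.source ∩ N')) := ⟨s a, ⟨ha, haN'⟩, hs a⟩
  have hC := pathComponentIn_mem_nhds ((hO.preimage hq).mem_nhds hm)
  refine Filter.mem_map.mpr (Filter.mem_of_superset hC fun b hb => hN'N ?_)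
  obtain ⟨η, hη⟩ := hb
  have hηt : ∀ t, q (η t) ∈ φ.target := fun t => by
    obtain ⟨z, hz, hzt⟩ := hη t
    rw [← hzt]
    exact φ.map_source hz.1
  -- Near `s a`, the lift of a small path is given by the inverse chart, so it ends inside the
  -- prescribed neighbourhood.
  have key : (fun t => φ.symm (q (η t))) =
      cov.liftPath (η.map hq) (s a) ((η.map hq).source.trans (hs a).symm) := by
    rw [cov.eq_liftPath_iff]
    refine ⟨?_, ?_, ?_⟩
    · exact φ.continuousOn_symm.comp_continuous (hq.comp η.continuous) hηt
    · funext t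
      exact φ.right_inv (hηt t)
    · simp only [Path.source]
      rw [← hs a, φ.left_inv ha]
  have hb' : φ.symm (q (η 1)) = s b :=
    (congrFun key 1).trans (congrArg Subtype.val (h a b η))
  obtain ⟨z, hz, hzt⟩ := hη 1
  rw [← hb', ← hzt, φ.left_inv hz.1]
  exact hz.2

/-! ### Morphisms of coverings as equivariant maps of fibres -/

namespace Cov

variable {X Y : Type u} [TopologicalSpace X] [TopologicalSpace Y]

/-- Each point is joined by a lifted path to the fibre over `y₀`; uniqueness of lifts carries the
equality back along it. -/
theorem hom_eq_of_eq_on_fiber [PathConnectedSpace Y] {E₁ E₂ : Cov Y} {s t : E₁ ⟶ E₂} (y₀ : Y)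
    (h : ∀ e, E₁.proj e = y₀ → Hom.map s e = Hom.map t e) : s = t := by
  apply Hom.ext
  ext e
  let γ := PathConnectedSpace.somePath (E₁.proj e) y₀
  let Γ := E₁.isCoveringMap.liftPath γ e γ.source
  have hΓ : E₁.proj (Γ 1) = y₀ :=
    (congrFun (E₁.isCoveringMap.liftPath_lifts γ e γ.source) 1).trans γ.target
  have := E₂.isCoveringMap.eq_of_comp_eq (g₁ := fun r => Hom.map s (Γ r))
    (g₂ := fun r => Hom.map t (Γ r)) (by fun_prop) (by fun_prop)
    (funext fun r => (Hom.comm s _).trans (Hom.comm t _).symm) 1 (h _ hΓ)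
  have h0 := congrFun this 0
  simpa only [Γ, IsCoveringMap.liftPath_zero] using h0

theorem exists_hom_of_natural [LocallyPathConnectedSpace Y] {E₁ E₂ : Cov Y}
    (τ : ∀ y, E₁.proj ⁻¹' {y} → E₂.proj ⁻¹' {y})
    (hτ : ∀ (y y' : Y) (γ : Quotient y y') (e : E₁.proj ⁻¹' {y}),
      τ y' (E₁.isCoveringMap.monodromy γ e) = E₂.isCoveringMap.monodromy γ (τ y e)) :
    ∃ t : E₁ ⟶ E₂, ∀ (y : Y) (e : E₁.proj ⁻¹' {y}), Hom.map t e.1 = (τ y e).1 := by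
  have : LocallyPathConnectedSpace E₁.total :=
    E₁.isCoveringMap.isLocalHomeomorph.locallyPathConnectedSpace
  have hs : ∀ e, E₂.proj (τ (E₁.proj e) ⟨e, rfl⟩).1 = E₁.proj e := fun e => (τ _ _).2
  have hc : Continuous fun e => (τ (E₁.proj e) ⟨e, rfl⟩).1 := by
    refine E₂.isCoveringMap.continuous_of_monodromy E₁.isCoveringMap.continuous hs
      fun a b η => ?_
    refine (hτ _ _ _ ⟨a, rfl⟩).symm.trans ?_
    exact congrArg _ (E₁.isCoveringMap.monodromy_map (.mk η))
  refine ⟨(⟨⟨_, hc⟩, hs⟩ : Hom E₁ E₂), ?_⟩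
  rintro _ ⟨e, rfl⟩
  rfl

/-- A map between fibres which is equivariant for the fundamental group extends to a morphism
of coverings. -/
theorem exists_hom_of_equivariant [PathConnectedSpace Y] [LocallyPathConnectedSpace Y]
    {E₁ E₂ : Cov Y} (y₀ : Y) (τ : E₁.proj ⁻¹' {y₀} → E₂.proj ⁻¹' {y₀})
    (hτ : ∀ (γ : Quotient y₀ y₀) (e : E₁.proj ⁻¹' {y₀}),
      τ (E₁.isCoveringMap.monodromy γ e) = E₂.isCoveringMap.monodromy γ (τ e)) :
    ∃ t : E₁ ⟶ E₂, ∀ e : E₁.proj ⁻¹' {y₀}, Hom.map t e.1 = (τ e).1 := by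
  let c (y : Y) : Quotient y₀ y := .mk (PathConnectedSpace.somePath y₀ y)
  -- Conjugate `τ` by the chosen paths `c`. Naturality in `γ` is equivariance for the loop `c y · γ
  -- · (c y')⁻¹`. Since `c y₀` need not be constant, equivariance is used again to recover `τ` on
  -- the fibre over `y₀`.
  obtain ⟨t, ht⟩ := exists_hom_of_natural (E₁ := E₁) (E₂ := E₂)
    (fun y e => E₂.isCoveringMap.monodromy (c y) (τ (E₁.isCoveringMap.monodromy (c y).symm e)))
    (fun y y' γ e => by
      have h := hτ ((c y).trans (γ.trans (c y').symm)) (E₁.isCoveringMap.monodromy (c y).symm e)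
      simp only [← IsCoveringMap.monodromy_trans_apply] at h ⊢
      rw [← Quotient.trans_assoc, Quotient.symm_trans, Quotient.refl_trans] at h
      rw [h, ← IsCoveringMap.monodromy_trans_apply]
      simp)
  refine ⟨t, fun e => ?_⟩
  rw [ht y₀ e, hτ, ← IsCoveringMap.monodromy_trans_apply, Quotient.symm_trans,
    IsCoveringMap.monodromy_refl, id]

/-- The map between fibres over `f x` induced by a morphism between pullbacks along `f`. -/
def pullbackFiberMap (f : C(X, Y)) {E₁ E₂ : Cov Y}
    (t : (pullback f).obj E₁ ⟶ (pullback f).obj E₂) (x : X) (e : E₁.proj ⁻¹' {f x}) :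
    E₂.proj ⁻¹' {f x} :=
  let w : PullbackTotal f E₂ := Hom.map t (⟨(x, e.1), e.2.symm⟩ : PullbackTotal f E₁)
  ⟨w.1.2, w.2.symm.trans (congrArg f (Hom.comm t _))⟩

/-- A lift `Γ` of `f ∘ γ` gives a path `(γ, Γ)` in the pullback; the second coordinate of its image
under `t` is again a lift of `f ∘ γ`. -/
theorem pullbackFiberMap_monodromy (f : C(X, Y)) {E₁ E₂ : Cov Y}
    (t : (pullback f).obj E₁ ⟶ (pullback f).obj E₂) {x x' : X} (γ : Quotient x x')
    (e : E₁.proj ⁻¹' {f x}) :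
    pullbackFiberMap f t x' (E₁.isCoveringMap.monodromy (γ.map f) e) =
      E₂.isCoveringMap.monodromy (γ.map f) (pullbackFiberMap f t x e) := by
  induction γ with | mk γ =>
  have h0 := (γ.map f.continuous).source.trans e.2.symm
  let Γ := E₁.isCoveringMap.liftPath (γ.map f.continuous) e.1 h0
  have hΓ : ∀ r, f (γ r) = E₁.proj (Γ r) := fun r =>
    (congrFun (E₁.isCoveringMap.liftPath_lifts (γ.map f.continuous) e.1 h0) r).symm
  let w (r : unitInterval) : PullbackTotal f E₂ :=
    Hom.map t (⟨(γ r, Γ r), hΓ r⟩ : PullbackTotal f E₁)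
  have hwc : Continuous w :=
    (Hom.map t).continuous.comp (((γ.continuous.prodMk Γ.continuous)).subtype_mk hΓ)
  have hw : ∀ r, (w r).1.1 = γ r := fun r => Hom.comm t _
  have key : (fun r => (w r).1.2) = E₂.isCoveringMap.liftPath (γ.map f.continuous)
      (pullbackFiberMap f t x e).1
      ((γ.map f.continuous).source.trans (pullbackFiberMap f t x e).2.symm) := by
    rw [IsCoveringMap.eq_liftPath_iff]
    refine ⟨by fun_prop, funext fun r => (w r).2.symm.trans (congrArg f (hw r)), ?_⟩
    have : (⟨(γ 0, Γ 0), hΓ 0⟩ : PullbackTotal f E₁) = ⟨(x, e.1), e.2.symm⟩ :=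
      Subtype.ext (Prod.ext γ.source (E₁.isCoveringMap.liftPath_zero _ _ _))
    change (Hom.map t _ : PullbackTotal f E₂).1.2 = _
    rw [this]
    rfl
  apply Subtype.ext
  refine Eq.trans ?_ (congrFun key 1)
  have : (⟨(γ 1, Γ 1), hΓ 1⟩ : PullbackTotal f E₁) =
      ⟨(x', Γ 1), (congrArg f γ.target).symm.trans (hΓ 1)⟩ :=
    Subtype.ext (Prod.ext γ.target rfl)
  change _ = (Hom.map t _ : PullbackTotal f E₂).1.2
  rw [this]
  rfl

theorem exists_hom_of_pullback_hom [PathConnectedSpace Y] [LocallyPathConnectedSpace Y]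
    (f : C(X, Y)) (x₀ : X) (hf : Function.Surjective (FundamentalGroup.map f x₀)) {E₁ E₂ : Cov Y}
    (t : (pullback f).obj E₁ ⟶ (pullback f).obj E₂) :
    ∃ s : E₁ ⟶ E₂, ∀ z : PullbackTotal f E₁, z.1.1 = x₀ →
      Hom.map s z.1.2 = (Hom.map t z : PullbackTotal f E₂).1.2 := by
  obtain ⟨s, hs⟩ := exists_hom_of_equivariant (f x₀) (pullbackFiberMap f t x₀) fun γ e => by
    obtain ⟨δ, rfl⟩ := hf γ
    exact pullbackFiberMap_monodromy f t (x := x₀) (x' := x₀) δ e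
  refine ⟨s, ?_⟩
  rintro ⟨⟨x, e⟩, he⟩ rfl
  exact hs ⟨e, he.symm⟩

theorem essentiallyInjective_pullback [PathConnectedSpace Y] [LocallyPathConnectedSpace Y]
    (f : C(X, Y)) (x₀ : X) (hf : Function.Surjective (FundamentalGroup.map f x₀)) :
    EssentiallyInjective (pullback f) := by
  rintro E₁ E₂ ⟨φ⟩
  have aux : ∀ (E₁ E₂ : Cov Y) (φ : (pullback f).obj E₁ ≅ (pullback f).obj E₂)
      (s : E₁ ⟶ E₂) (s' : E₂ ⟶ E₁)
      (_ : ∀ z : PullbackTotal f E₁, z.1.1 = x₀ →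
        Hom.map s z.1.2 = (Hom.map φ.hom z : PullbackTotal f E₂).1.2)
      (_ : ∀ z : PullbackTotal f E₂, z.1.1 = x₀ →
        Hom.map s' z.1.2 = (Hom.map φ.inv z : PullbackTotal f E₁).1.2), s ≫ s' = 𝟙 E₁ := by
    intro E₁ E₂ φ s s' hs hs'
    refine hom_eq_of_eq_on_fiber (f x₀) fun e he => ?_
    let z : PullbackTotal f E₁ := ⟨(x₀, e), he.symm⟩
    let w : PullbackTotal f E₂ := Hom.map φ.hom z
    have hw : w.1.1 = x₀ := Hom.comm φ.hom z
    have hz : (Hom.map φ.inv w : PullbackTotal f E₁) = z :=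
      congrArg (fun k : (pullback f).obj E₁ ⟶ _ => (Hom.map k z : PullbackTotal f E₁))
        φ.hom_inv_id
    change Hom.map s' (Hom.map s z.1.2) = e
    rw [hs z rfl, hs' w hw, hz]
  obtain ⟨s, hs⟩ := exists_hom_of_pullback_hom f x₀ hf φ.hom
  obtain ⟨s', hs'⟩ := exists_hom_of_pullback_hom f x₀ hf φ.inv
  exact ⟨⟨s, s', aux E₁ E₂ φ s s' hs hs', aux E₂ E₁ φ.symm s' s hs' hs⟩⟩

end Cov

/-! ### Coverings from local systems -/

/-- A local system of sets on `Y`: a functor from the fundamental groupoid of `Y` to sets. -/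
structure LocalSystem (Y : Type u) [TopologicalSpace Y] where
  fib : Y → Type u
  map : ∀ {y y' : Y}, Quotient y y' → fib y → fib y'
  map_refl : ∀ (y : Y) (a : fib y), map (.refl y) a = a
  map_trans : ∀ {y y' y'' : Y} (γ : Quotient y y') (δ : Quotient y' y'') (a : fib y),
    map (γ.trans δ) a = map δ (map γ a)

namespace LocalSystem

variable {X Y : Type u} [TopologicalSpace X] [TopologicalSpace Y]

theorem map_symm_map (F : LocalSystem Y) {y y' : Y} (γ : Quotient y y') (a : F.fib y) :
    F.map γ.symm (F.map γ a) = a := by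
  rw [← F.map_trans, Quotient.trans_symm, F.map_refl]

theorem map_map_symm (F : LocalSystem Y) {y y' : Y} (γ : Quotient y y') (a : F.fib y') :
    F.map γ (F.map γ.symm a) = a := by
  rw [← F.map_trans, Quotient.symm_trans, F.map_refl]

theorem map_injective (F : LocalSystem Y) {y y' : Y} (γ : Quotient y y') :
    Function.Injective (F.map γ) :=
  Function.LeftInverse.injective (F.map_symm_map γ)

/-- The total space of a local system. -/
structure Total (F : LocalSystem Y) : Type u where
  base : Y
  val : F.fib base

/-- A set is open if it is stable under transport of each of its points along all sufficiently
small paths. -/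
instance (F : LocalSystem Y) : TopologicalSpace F.Total where
  IsOpen V := ∀ (y : Y) (a : F.fib y), (⟨y, a⟩ : F.Total) ∈ V →
    ∃ W ∈ 𝓝 y, ∀ (y' : Y) (γ : Path y y'), (∀ t, γ t ∈ W) →
      (⟨y', F.map (.mk γ) a⟩ : F.Total) ∈ V
  isOpen_univ _ _ _ := ⟨Set.univ, Filter.univ_mem, fun _ _ _ => trivial⟩
  isOpen_inter V V' hV hV' y a h := by
    obtain ⟨W, hW, H⟩ := hV y a h.1
    obtain ⟨W', hW', H'⟩ := hV' y a h.2
    exact ⟨W ∩ W', Filter.inter_mem hW hW', fun y' γ hγ =>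
      ⟨H y' γ fun t => (hγ t).1, H' y' γ fun t => (hγ t).2⟩⟩
  isOpen_sUnion S hS y a h := by
    obtain ⟨V, hV, hm⟩ := h
    obtain ⟨W, hW, H⟩ := hS V hV y a hm
    exact ⟨W, hW, fun y' γ hγ => ⟨V, hV, H y' γ hγ⟩⟩

theorem isOpen_total_iff {F : LocalSystem Y} {V : Set F.Total} :
    IsOpen V ↔ ∀ (y : Y) (a : F.fib y), (⟨y, a⟩ : F.Total) ∈ V →
      ∃ W ∈ 𝓝 y, ∀ (y' : Y) (γ : Path y y'), (∀ t, γ t ∈ W) →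
        (⟨y', F.map (.mk γ) a⟩ : F.Total) ∈ V :=
  Iff.rfl

/-- The projection of the total space to the base. -/
def proj (F : LocalSystem Y) (z : F.Total) : Y := z.base

theorem continuous_proj (F : LocalSystem Y) : Continuous F.proj := by
  refine continuous_def.mpr fun U hU => isOpen_total_iff.mpr fun y a h => ?_
  exact ⟨U, hU.mem_nhds h, fun y' γ hγ => by simpa using! hγ 1⟩

/-- A section of a local system along a continuous map is continuous if it is flat. -/
theorem continuous_of_flat (F : LocalSystem Y) {A : Type*} [TopologicalSpace A]
    [LocallyPathConnectedSpace A] {q : A → Y} (hq : Continuous q) (s : ∀ a, F.fib (q a))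
    (hs : ∀ (a b : A) (η : Path a b), F.map (.mk (η.map hq)) (s a) = s b) :
    Continuous fun a => (⟨q a, s a⟩ : F.Total) := by
  refine continuous_def.mpr fun V hV => isOpen_iff_mem_nhds.mpr fun a ha => ?_
  obtain ⟨W, hW, H⟩ := isOpen_total_iff.mp hV _ _ ha
  refine Filter.mem_of_superset (pathComponentIn_mem_nhds (hq.continuousAt hW)) ?_
  rintro b ⟨η, hη⟩
  have := H _ (η.map hq) hη
  rwa [hs] at this

theorem exists_isOpen_isPathConnected_homotopic [LocallyPathConnectedSpace Y]
    [SemilocallySimplyConnectedSpace Y] (y : Y) :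
    ∃ U : Set Y, IsOpen U ∧ y ∈ U ∧ IsPathConnected U ∧ ∀ (y' : Y) (γ δ : Path y y'),
      (∀ t, γ t ∈ U) → (∀ t, δ t ∈ U) → (.mk γ : Quotient y y') = .mk δ := by
  obtain ⟨U₀, hU₀, H⟩ := SemilocallySimplyConnectedSpace.exists_nhds_homotopic_refl y
  obtain ⟨U, ⟨hU, hyU, hpc⟩, hUU₀⟩ := (isOpen_isPathConnected_basis y).mem_iff.mp hU₀
  refine ⟨U, hU, hyU, hpc, fun y' γ δ hγ hδ => ?_⟩
  have h := H (γ.trans δ.symm) (by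
    rw [Path.trans_range, Path.symm_range]
    refine (Set.union_subset ?_ ?_).trans hUU₀ <;> rintro _ ⟨t, rfl⟩
    exacts [hγ t, hδ t])
  let γ' : Quotient y y' := .mk γ
  let δ' : Quotient y y' := .mk δ
  have h' : γ'.trans δ'.symm = .refl y := Quotient.eq.mpr h
  calc γ' = (γ'.trans δ'.symm).trans δ' := by simp
    _ = δ' := by rw [h', Quotient.refl_trans]

/-- Over a small `U`, all paths in `U` from `y` to a given point are homotopic in `Y`, so transport
along them trivialises the total space. -/
theorem isCoveringMap_proj [LocallyPathConnectedSpace Y] [SemilocallySimplyConnectedSpace Y]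
    (F : LocalSystem Y) : IsCoveringMap F.proj := by
  intro y
  obtain ⟨U, hU, hyU, hpc, huniq⟩ := exists_isOpen_isPathConnected_homotopic y
  have hj : ∀ y' : U, JoinedIn U y y' := fun y' => hpc.joinedIn y hyU y' y'.2
  let c (y' : U) : Quotient y y'.1 := .mk (hj y').somePath
  have hc : ∀ (y' y'' : U) (γ : Path y'.1 y''.1), (∀ t, γ t ∈ U) →
      (c y').trans (.mk γ) = c y'' := by
    intro y' y'' γ hγ
    refine huniq _ ((hj y').somePath.trans γ) _ (fun t => ?_) (hj y'').somePath_mem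
    have : (hj y').somePath.trans γ t ∈ Set.range ((hj y').somePath.trans γ) := ⟨t, rfl⟩
    rw [Path.trans_range] at this
    rcases this with ⟨r, hr⟩ | ⟨r, hr⟩
    · exact hr ▸ (hj y').somePath_mem r
    · exact hr ▸ hγ r
  let _ : TopologicalSpace (F.fib y) := ⊥
  have : DiscreteTopology (F.fib y) := ⟨rfl⟩
  have key : IsEvenlyCovered F.proj y (F.fib y) := by
    refine ⟨inferInstance, U, hyU, hU, hU.preimage F.continuous_proj,
      { toFun := fun z => (⟨z.1.1, z.2⟩, F.map (c ⟨z.1.1, z.2⟩).symm z.1.val)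
        invFun := fun w => ⟨(⟨w.1.1, F.map (c w.1) w.2⟩ : F.Total), w.1.2⟩
        left_inv := ?_
        right_inv := ?_
        continuous_toFun := ?_
        continuous_invFun := ?_ }, fun _ => rfl⟩
    · rintro ⟨⟨y', a⟩, hy'⟩
      exact Subtype.ext (congrArg (Total.mk y') (F.map_map_symm _ _))
    · rintro ⟨y', a⟩
      exact Prod.ext rfl (F.map_symm_map _ _)
    · refine Continuous.prodMk ((F.continuous_proj.comp continuous_subtype_val).subtype_mk _) ?_
      refine continuous_discrete_rng.mpr fun a => ?_
      -- The sheet through `a`: it is open because by `hc` transport within `U` does not leave it.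
      refine ⟨{z | ∃ y' : U, z = (⟨y'.1, F.map (c y') a⟩ : F.Total)}, ?_, ?_⟩
      · refine isOpen_total_iff.mpr ?_
        rintro y' b ⟨y'', h⟩
        obtain ⟨y', hy'⟩ : ∃ v : U, v.1 = y' := ⟨y'', (congrArg Total.base h).symm⟩
        subst hy'
        obtain rfl : y' = y'' := Subtype.ext (congrArg Total.base h)
        obtain rfl : b = F.map (c y') a := eq_of_heq (Total.mk.inj h).2
        refine ⟨U, hU.mem_nhds y'.2, fun v γ hγ => ?_⟩
        have hv : v ∈ U := by simpa using hγ 1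
        refine ⟨⟨v, hv⟩, ?_⟩
        rw [← hc y' ⟨v, hv⟩ γ hγ, F.map_trans]
      · ext ⟨⟨y', b⟩, hy'⟩
        constructor
        · rintro ⟨y'', h⟩
          obtain rfl : (⟨y', hy'⟩ : U) = y'' := Subtype.ext (congrArg Total.base h)
          have hb : b = F.map (c ⟨y', hy'⟩) a := eq_of_heq (Total.mk.inj h).2
          change F.map (c ⟨y', hy'⟩).symm b = a
          rw [hb, F.map_symm_map]
        · rintro rfl
          exact ⟨⟨y', hy'⟩, congrArg (Total.mk y') (F.map_map_symm _ _).symm⟩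
    · refine Continuous.subtype_mk (continuous_prod_of_discrete_right.mpr fun a => ?_) _
      have : LocallyPathConnectedSpace U := hU.locallyPathConnectedSpace
      refine F.continuous_of_flat continuous_subtype_val (fun y' => F.map (c y') a) fun v v' η => ?_
      rw [← F.map_trans, hc _ _ _ fun t => (η t).2]
  exact key.to_isEvenlyCovered_preimage

section Covering

variable [LocallyPathConnectedSpace Y] [SemilocallySimplyConnectedSpace Y]

/-- The covering associated with a local system. -/
def toCov (F : LocalSystem Y) : Cov Y := ⟨F.Total, F.proj, F.isCoveringMap_proj⟩

/-- Every path in the total space transports its source to its target. -/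
theorem map_path (F : LocalSystem Y) {z z' : F.Total} (η : Path z z') :
    F.map (.mk (η.map F.continuous_proj)) z.val = z'.val := by
  have : LocallyPathConnectedSpace unitInterval := (convex_Icc (0 : ℝ) 1).locallyPathConnectedSpace
  have : ContractibleSpace unitInterval := (convex_Icc (0 : ℝ) 1).contractibleSpace ⟨0, by simp⟩
  obtain ⟨η, rfl, rfl⟩ := η
  let q : C(unitInterval, Y) := ⟨fun t => F.proj (η t), F.continuous_proj.comp η.continuous⟩
  let c (t : unitInterval) : Quotient 0 t := .mk (PathConnectedSpace.somePath 0 t)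
  let a₀ : F.fib (q 0) := (η 0).val
  -- Transport `a₀` along the interval, where path classes are unique. The result is a lift of `q`
  -- with the same start as `η`, hence equal to `η`.
  let s (t : unitInterval) : F.fib (q t) := F.map ((c t).map q) a₀
  have hs : Continuous fun t => (⟨q t, s t⟩ : F.Total) := by
    refine F.continuous_of_flat q.continuous s fun a b δ => ?_
    change F.map ((.mk δ : Quotient a b).map q) (F.map ((c a).map q) a₀) =
      F.map ((c b).map q) a₀
    rw [← F.map_trans, ← Quotient.map_trans, Subsingleton.elim ((c a).trans (.mk δ)) (c b)]
  have heq := F.isCoveringMap_proj.eq_of_comp_eq hs η.continuous rfl 0 (by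
    refine congrArg (Total.mk (q 0)) ?_
    change F.map ((c 0).map q) a₀ = a₀
    rw [Subsingleton.elim (c 0) (.refl 0)]
    exact F.map_refl _ _)
  have h1 : s 1 = (η 1).val := eq_of_heq (Total.mk.inj (congrFun heq 1)).2
  let ι : Path (0 : unitInterval) 1 := ⟨.id _, rfl, rfl⟩
  refine Eq.trans ?_ h1
  change F.map ((.mk ι : Quotient _ _).map q) a₀ = F.map ((c 1).map q) a₀
  rw [Subsingleton.elim (c 1) (.mk ι)]

/-- A continuous section of the total space is flat. -/
theorem exists_flat_of_section (F : LocalSystem Y) {s : Y → F.Total} (hs : Continuous s)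
    (h : ∀ y, F.proj (s y) = y) :
    ∃ a : ∀ y, F.fib y, ∀ (y y' : Y) (γ : Quotient y y'), F.map γ (a y) = a y' := by
  have : ∀ y, ∃ a : F.fib y, s y = ⟨y, a⟩ := fun y => by
    rcases hz : s y with ⟨y', a⟩
    obtain rfl : y' = y := (congrArg F.proj hz).symm.trans (h y)
    exact ⟨a, rfl⟩
  choose a ha using this
  obtain rfl : s = fun y => ⟨y, a y⟩ := funext ha
  refine ⟨a, fun y y' γ => ?_⟩
  induction γ with | mk γ =>
  exact F.map_path (γ.map hs)

theorem exists_pullback_hom [LocallyPathConnectedSpace X] (f : C(X, Y)) (F G : LocalSystem Y)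
    (τ : ∀ x, F.fib (f x) → G.fib (f x))
    (hτ : ∀ (x x' : X) (γ : Quotient x x') (a : F.fib (f x)),
      τ x' (F.map (γ.map f) a) = G.map (γ.map f) (τ x a)) :
    ∃ t : (Cov.pullback f).obj F.toCov ⟶ (Cov.pullback f).obj G.toCov,
      ∀ (x : X) (a : F.fib (f x)),
        Cov.Hom.map t (⟨(x, (⟨f x, a⟩ : F.Total)), rfl⟩ : Cov.PullbackTotal f F.toCov) =
          (⟨(x, (⟨f x, τ x a⟩ : G.Total)), rfl⟩ : Cov.PullbackTotal f G.toCov) := by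
  let P := Cov.PullbackTotal f F.toCov
  have : LocallyPathConnectedSpace P :=
    (Cov.isCoveringMap_pullback f F.toCov).isLocalHomeomorph.locallyPathConnectedSpace
  have hq : Continuous fun z : P => f z.1.1 := by fun_prop
  let σ (z : P) : G.fib (f z.1.1) :=
    -- The point `z.1.2` lies over `f z.1.1` only up to a propositional equality, hence the cast.
    τ z.1.1 (cast (congrArg F.fib z.2.symm) (Total.val (F := F) z.1.2))
  have hσ : Continuous fun z : P => (⟨f z.1.1, σ z⟩ : G.Total) := by
    refine G.continuous_of_flat hq σ ?_
    rintro ⟨⟨x, ⟨y, a⟩⟩, h⟩ ⟨⟨x', ⟨y', a'⟩⟩, h'⟩ η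
    obtain rfl : f x = y := h
    obtain rfl : f x' = y' := h'
    have hη₁ : Continuous fun z : P => z.1.1 := by fun_prop
    have hη₂ : Continuous fun z : P => (z.1.2 : F.Total) :=
      continuous_snd.comp continuous_subtype_val
    have h₂ : F.map (y := f x) (y' := f x') (.mk ((η.map hη₂).map F.continuous_proj)) a = a' :=
      F.map_path (η.map hη₂)
    have h₁ := hτ x x' (.mk (η.map hη₁)) a
    have e : ((η.map hη₂).map F.continuous_proj : Path (f x) (f x')) =
        (η.map hη₁).map f.continuous := by
      ext t
      exact (η t).2.symm
    rw [e] at h₂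
    exact h₁.symm.trans (congrArg (τ x') h₂)
  refine ⟨(⟨⟨fun z : P => (⟨(z.1.1, (⟨f z.1.1, σ z⟩ : G.Total)), rfl⟩ : Cov.PullbackTotal f G.toCov),
    ?_⟩, fun _ => rfl⟩ : Cov.Hom _ _), fun _ _ => rfl⟩
  exact ((continuous_fst.comp continuous_subtype_val).prodMk hσ).subtype_mk _

/-- Two local systems on `Y` whose inverse images on `X` are isomorphic have isomorphic pullback
coverings. -/
theorem nonempty_pullback_iso [LocallyPathConnectedSpace X] (f : C(X, Y)) (F G : LocalSystem Y)
    (τ : ∀ x, F.fib (f x) ≃ G.fib (f x))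
    (hτ : ∀ (x x' : X) (γ : Quotient x x') (a : F.fib (f x)),
      τ x' (F.map (γ.map f) a) = G.map (γ.map f) (τ x a)) :
    Nonempty ((Cov.pullback f).obj F.toCov ≅ (Cov.pullback f).obj G.toCov) := by
  obtain ⟨t, ht⟩ := exists_pullback_hom f F G (fun x => τ x) hτ
  obtain ⟨t', ht'⟩ := exists_pullback_hom f G F (fun x => (τ x).symm) fun x x' γ a => by
    rw [Equiv.symm_apply_eq, hτ, Equiv.apply_symm_apply]
  refine ⟨⟨t, t', ?_, ?_⟩⟩
  · apply Cov.Hom.ext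
    ext z
    obtain ⟨⟨x, ⟨y, a⟩⟩, h⟩ := z
    obtain rfl : f x = y := h
    refine (congrArg _ (ht x a)).trans ((ht' x _).trans ?_)
    rw [Equiv.symm_apply_apply]
    rfl
  · apply Cov.Hom.ext
    ext z
    obtain ⟨⟨x, ⟨y, a⟩⟩, h⟩ := z
    obtain rfl : f x = y := h
    refine (congrArg _ (ht' x a)).trans ((ht x _).trans ?_)
    rw [Equiv.apply_symm_apply]
    rfl

end Covering

/-! ### The local system of cosets -/

/-- The product of a local system with a constant set. -/
def prodConst (F : LocalSystem Y) (N : Type) : LocalSystem Y where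
  fib y := F.fib y × N
  map γ a := (F.map γ a.1, a.2)
  map_refl y a := Prod.ext (F.map_refl y a.1) rfl
  map_trans γ δ a := Prod.ext (F.map_trans γ δ a.1) rfl

/-- The disjoint union of a local system with the terminal one. -/
def option (F : LocalSystem Y) : LocalSystem Y where
  fib y := Option (F.fib y)
  map γ := Option.map (F.map γ)
  map_refl y a := by cases a <;> simp [F.map_refl]
  map_trans γ δ a := by cases a <;> simp [F.map_trans]

/-- Homotopy classes of paths from `f x₀`, up to loops which are images of loops at `x₀`. -/
noncomputable def coset (f : C(X, Y)) (x₀ : X) : LocalSystem Y where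
  fib y := _root_.Quotient (α := Quotient (f x₀) y)
    { r := fun γ δ => ∃ l : Quotient x₀ x₀, (l.map f).trans γ = δ
      iseqv :=
        { refl := fun γ => ⟨.refl x₀, Quotient.refl_trans γ⟩
          symm := by
            rintro γ _ ⟨l, rfl⟩
            exact ⟨l.symm, by simp [Quotient.map_symm, ← Quotient.trans_assoc]⟩
          trans := by
            rintro γ _ _ ⟨l, rfl⟩ ⟨l', rfl⟩
            exact ⟨l'.trans l, by simp [Quotient.map_trans]⟩ } }
  map δ := Quotient.map (fun γ => γ.trans δ) (by
    rintro γ _ ⟨l, rfl⟩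
    exact ⟨l, (Quotient.trans_assoc _ _ _).symm⟩)
  map_refl y := by
    rintro ⟨γ⟩
    exact congrArg (Quot.mk _) (Quotient.trans_refl γ)
  map_trans γ δ := by
    rintro ⟨a⟩
    exact congrArg (Quot.mk _) (Quotient.trans_assoc a γ δ).symm

/-- The class of a path in the local system of cosets. -/
noncomputable def coset.mk (f : C(X, Y)) (x₀ : X) {y : Y} (γ : Quotient (f x₀) y) : (coset f x₀).fib y :=
  Quot.mk _ γ

theorem coset.mk_eq_mk_iff {f : C(X, Y)} {x₀ : X} {y : Y} {γ δ : Quotient (f x₀) y} :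
    coset.mk f x₀ γ = coset.mk f x₀ δ ↔ ∃ l : Quotient x₀ x₀, (l.map f).trans γ = δ :=
  _root_.Quotient.eq

theorem coset.map_mk (f : C(X, Y)) (x₀ : X) {y y' : Y} (γ : Quotient (f x₀) y)
    (δ : Quotient y y') : (coset f x₀).map δ (coset.mk f x₀ γ) = coset.mk f x₀ (γ.trans δ) :=
  rfl

/-- If some coset is invariant under all loops, then `f` is surjective on fundamental groups. -/
theorem surjective_of_coset_invariant (f : C(X, Y)) (x₀ : X) (a : (coset f x₀).fib (f x₀))
    (ha : ∀ γ : Quotient (f x₀) (f x₀), (coset f x₀).map γ a = a) :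
    Function.Surjective (FundamentalGroup.map f x₀) := by
  intro g
  obtain ⟨c, rfl⟩ : ∃ c, coset.mk f x₀ c = a := Quot.exists_rep a
  let g' : Quotient (f x₀) (f x₀) := g
  -- This loop carries the class of `c` to that of `g' · c`, so `g' · c` is `f(l) · c` for some `l`;
  -- then cancel `c`.
  have h := (ha (c.symm.trans (g'.trans c))).symm
  rw [coset.map_mk, coset.mk_eq_mk_iff] at h
  obtain ⟨l, hl⟩ := h
  refine ⟨l, ?_⟩
  change l.map f = g'
  rw [← Quotient.trans_assoc, Quotient.trans_symm, Quotient.refl_trans] at hl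
  simpa using congrArg (fun k => k.trans c.symm) hl

end LocalSystem

/-! ### Hilbert's hotel and the converse -/

open scoped Classical in
/-- A shift along `{s₀} × ℕ` splits off one point from `S × ℕ`. -/
noncomputable def prodNatEquivOption {S : Type*} (s₀ : S) : S × ℕ ≃ Option (S × ℕ) where
  toFun z := if z.1 = s₀ then (if z.2 = 0 then none else some (z.1, z.2 - 1)) else some z
  invFun
    | none => (s₀, 0)
    | some z => if z.1 = s₀ then (z.1, z.2 + 1) else z
  left_inv z := by grind
  right_inv z := by rcases z with _ | z <;> grind

/-- The shift is natural for injections of pointed sets, so applied along a flat section it commutes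
with transport. -/
theorem prodNatEquivOption_map {S T : Type*} {m : S → T} (hm : Function.Injective m) (s₀ : S)
    (z : S × ℕ) : prodNatEquivOption (m s₀) (m z.1, z.2) =
      (prodNatEquivOption s₀ z).map fun w => (m w.1, w.2) := by
  by_cases h : z.1 = s₀ <;> by_cases h' : z.2 = 0 <;>
    simp [prodNatEquivOption, hm.eq_iff, h, h']

theorem LocalSystem.surjective_of_essentiallyInjective {X Y : Type u} [TopologicalSpace X]
    [TopologicalSpace Y] [PathConnectedSpace X] [LocallyPathConnectedSpace X]
    [LocallyPathConnectedSpace Y] [SemilocallySimplyConnectedSpace Y] (f : C(X, Y)) (x₀ : X)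
    (hf : EssentiallyInjective (Cov.pullback f)) :
    Function.Surjective (FundamentalGroup.map f x₀) := by
  let F := coset f x₀
  let c (x : X) : Quotient x₀ x := .mk (PathConnectedSpace.somePath x₀ x)
  let g (x : X) : F.fib (f x) := coset.mk f x₀ ((c x).map f)
  -- Two paths in `X` from `x₀` to the same point differ by a loop in `X`, which the coset ignores.
  have hg : ∀ (x x' : X) (γ : Quotient x x'), F.map (γ.map f) (g x) = g x' := fun x x' γ => by
    refine (coset.map_mk ..).trans (coset.mk_eq_mk_iff.mpr ⟨(c x').trans ((c x).trans γ).symm, ?_⟩)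
    rw [← Quotient.map_trans, ← Quotient.map_trans, Quotient.trans_assoc, Quotient.symm_trans,
      Quotient.trans_refl]
  obtain ⟨φ⟩ := hf _ _ (nonempty_pullback_iso f (F.prodConst ℕ) (F.prodConst ℕ).option
    (fun x => prodNatEquivOption (g x)) fun x x' γ a => by
      rw [← hg x x' γ]
      exact prodNatEquivOption_map (F.map_injective (γ.map f)) (g x) a)
  -- The added sheet is a section over all of `Y`; `φ.inv` moves it into `F × ℕ`.
  have hs : Continuous fun y : Y => (⟨y, none⟩ : (F.prodConst ℕ).option.Total) :=
    (F.prodConst ℕ).option.continuous_of_flat continuous_id (fun _ => none) fun _ _ _ => rfl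
  obtain ⟨a, ha⟩ := (F.prodConst ℕ).exists_flat_of_section
    ((Cov.Hom.map φ.inv).continuous.comp hs) fun y => Cov.Hom.comm φ.inv _
  exact surjective_of_coset_invariant f x₀ (a (f x₀)).1 fun γ => congrArg Prod.fst (ha _ _ γ)

theorem mainTheorem4 {X Y : Type u} [TopologicalSpace X] [TopologicalSpace Y]
    [ConnectedSpace X] [LocallyPathConnectedSpace X] [SemilocallySimplyConnectedSpace X]
    [ConnectedSpace Y] [LocallyPathConnectedSpace Y] [SemilocallySimplyConnectedSpace Y]
    (f : C(X, Y)) (x₀ : X) :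
    Function.Surjective (FundamentalGroup.map f x₀) ↔ EssentiallyInjective (Cov.pullback f) := by
  have : PathConnectedSpace X := pathConnectedSpace_iff_connectedSpace.mpr inferInstance
  have : PathConnectedSpace Y := pathConnectedSpace_iff_connectedSpace.mpr inferInstance
  exact ⟨Cov.essentiallyInjective_pullback f x₀,
    LocalSystem.surjective_of_essentiallyInjective f x₀⟩
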